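/- All Hilbert spaces are complex. A (unilateral, forward) shift operator on a Hilbert space $\mathcal H$ is a linear isometry $S_+$ of $\mathcal H$ into itself for which there is a closed subspace $\mathcal L\subset\mathcal H$ such that the subspaces $S_+^n\mathcal L$ ($n\ge 0$) are pairwise orthogonal and $\mathcal H=\bigoplus_{n\ge 0}S_+^n\mathcal L$. A Hankel operator (with respect to $S_+$) is a bounded linear operator $C$ on $\mathcal H$ with $CS_+=S_+^*C$. A Foguel–Hankel operator is an operator on $\mathcal H\oplus\mathcal H$ of the form $$T=\begin{pmatrix}S_+^*&C\\0&S_+\end{pmatrix},$$ where $S_+$ is a shift operator on a Hilbert space $\mathcal H$ and $C$ is a Hankel operator with respect to $S_+$. A bounded linear operator $S$ on a Hilbert space $\mathcal K$ is a $3$-isometry if $I-3S^*S+3S^{*2}S^2-S^{*3}S^3=0$, and it is a lifting of a bounded linear operator $T$ on a closed subspace $\mathcal G$ of $\mathcal K$ if $TP_{\mathcal G}=P_{\mathcal G}S$, where $P_{\mathcal G}$ is the orthogonal projection of $\mathcal K$ onto $\mathcal G$. Corollary. Every Foguel–Hankel operator $T$ on $\mathcal H\oplus\mathcal H$ has a $3$-isometric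 lifting: there are a Hilbert space $\mathcal K$ containing $\mathcal H\oplus\mathcal H$ as a closed subspace and a $3$-isometry $S$ on $\mathcal K$ which is a lifting of $T$. -/

import Mathlib

open scoped InnerProductSpace

/-- `V` is a (unilateral, forward) shift operator on the Hilbert space `H`, of arbitrary
multiplicity: `V` is an isometry for which there is a closed wandering subspace `L`
(the subspaces `V ^ n L` are pairwise orthogonal) such that `H` is the
orthogonal sum of the `V ^ n L`, `n ≥ 0`. -/
structure IsShiftOperator {H : Type*} [NormedAddCommGroup H] [InnerProductSpace ℂ H]
    (V : H →L[ℂ] H) : Prop where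
  isometry : ∀ x, ‖V x‖ = ‖x‖
  exists_wandering : ∃ L : Submodule ℂ H, IsClosed (L : Set H) ∧
    (∀ m n : ℕ, m ≠ n → ∀ x ∈ L, ∀ y ∈ L, ⟪(V ^ m) x, (V ^ n) y⟫_ℂ = 0) ∧
    (⨆ n : ℕ, L.map ((V ^ n : H →L[ℂ] H) : H →ₗ[ℂ] H)).topologicalClosure = ⊤

/-- `C` is a bounded Hankel operator with respect to the shift `V`: `C V = V* C`. -/
def IsHankelOperator {H : Type*} [NormedAddCommGroup H] [InnerProductSpace ℂ H] [CompleteSpace H]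
    (V C : H →L[ℂ] H) : Prop :=
  C ∘L V = V.adjoint ∘L C

/-- The upper triangular block operator `(A, C; 0, B)` on the Hilbert space direct sum
`H₀ ⊕ H₁`, i.e. `(x, y) ↦ (A x + C y, B y)`. -/
noncomputable def upperBlock {H₀ H₁ : Type*} [NormedAddCommGroup H₀] [InnerProductSpace ℂ H₀]
    [NormedAddCommGroup H₁] [InnerProductSpace ℂ H₁]
    (A : H₀ →L[ℂ] H₀) (C : H₁ →L[ℂ] H₀) (B : H₁ →L[ℂ] H₁) :
    WithLp 2 (H₀ × H₁) →L[ℂ] WithLp 2 (H₀ × H₁) :=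
  ((WithLp.prodContinuousLinearEquiv 2 ℂ H₀ H₁).symm :
      (H₀ × H₁) →L[ℂ] WithLp 2 (H₀ × H₁)) ∘L
    (A ∘L WithLp.fstL 2 ℂ H₀ H₁ + C ∘L WithLp.sndL 2 ℂ H₀ H₁).prod
      (B ∘L WithLp.sndL 2 ℂ H₀ H₁)

/-- `T` is a Foguel–Hankel operator on `H ⊕ H`: it is `(V*, C; 0, V)` for some shift operator `V`
on `H` and some Hankel operator `C` with respect to `V`. -/
def IsFoguelHankel {H : Type*} [NormedAddCommGroup H] [InnerProductSpace ℂ H] [CompleteSpace H]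
    (T : WithLp 2 (H × H) →L[ℂ] WithLp 2 (H × H)) : Prop :=
  ∃ V C : H →L[ℂ] H, IsShiftOperator V ∧ IsHankelOperator V C ∧ T = upperBlock V.adjoint C V

/-- `S` is an `m`-isometry: `∑_{j=0}^m (-1)^j (m choose j) S*^j S^j = 0`. -/
def IsMIsometry {K : Type*} [NormedAddCommGroup K] [InnerProductSpace ℂ K] [CompleteSpace K]
    (m : ℕ) (S : K →L[ℂ] K) : Prop :=
  ∑ j ∈ Finset.range (m + 1), ((-1 : ℂ) ^ j * (m.choose j : ℂ)) • (S.adjoint ^ j * S ^ j) = 0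

/-- `S` on `K` is a lifting of `T` on `H`, where `H` is regarded as a closed subspace of `K` through
the linear isometry `ι`: `T P = P S`, where `P : K → H` is the orthogonal projection of `K` onto
(the copy in `K` of) `H`, which is the adjoint of `ι`. -/
def IsLifting {H K : Type*} [NormedAddCommGroup H] [InnerProductSpace ℂ H] [CompleteSpace H]
    [NormedAddCommGroup K] [InnerProductSpace ℂ K] [CompleteSpace K]
    (ι : H →ₗᵢ[ℂ] K) (T : H →L[ℂ] H) (S : K →L[ℂ] K) : Prop :=
  T ∘L ι.toContinuousLinearMap.adjoint = ι.toContinuousLinearMap.adjoint ∘L S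

/-- `T` has an `m`-isometric lifting on some Hilbert space containing `H`. -/
def HasMIsometricLifting.{u} {H : Type u} [NormedAddCommGroup H] [InnerProductSpace ℂ H]
    [CompleteSpace H] (m : ℕ) (T : H →L[ℂ] H) : Prop :=
  ∃ (K : Type u) (_ : NormedAddCommGroup K) (_ : InnerProductSpace ℂ K) (_ : CompleteSpace K)
    (ι : H →ₗᵢ[ℂ] K) (S : K →L[ℂ] K), IsMIsometry m S ∧ IsLifting ι T S

/-! Seek the lifting as S = (W, B; 0, V) on K ⊕ H, where K ⊇ H, W is an isometry whose adjoint
extends V, B lifts C, and W B = B V. For n ≥ 1 the commutation gives S^n (x, y) = (W^(n-1) (W x + n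
B y), V^n y), so ‖S^n z‖² is quadratic in n and its third difference vanishes
(`isMIsometry_three_upperBlock`).

To find W and B (`exists_isometric_lifting_of_hankel`), scale C to a contraction C₀ with defect
operator D and let B y be (C₀ y, D y) up to the scale. Then W must send (V x, 0) to (x, 0) and (C₀
y, D y) to (C₀ V y, D V y). The relation C V = V* C makes this prescription norm preserving, so it
extends to a contraction of H ⊕ H (`exists_contraction_of_norm_eq`), and an isometric dilation keeps
its values wherever it is already isometric (`exists_isometry_dilation`). -/

section Dilation

variable {H M X : Type*} [NormedAddCommGroup H] [InnerProductSpace ℂ H]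
  [NormedAddCommGroup M] [InnerProductSpace ℂ M] [NormedAddCommGroup X] [InnerProductSpace ℂ X]

/-- A contraction `C` on a Hilbert space has a defect operator `D`, with `C* C + D* D = 1`. -/
lemma exists_defect_operator [CompleteSpace H] (C : H →L[ℂ] H) (hC : ∀ x, ‖C x‖ ≤ ‖x‖) :
    ∃ D : H →L[ℂ] H, ∀ x, ‖C x‖ ^ 2 + ‖D x‖ ^ 2 = ‖x‖ ^ 2 := by
  have h : (0 : H →L[ℂ] H) ≤ 1 - C.adjoint * C := by
    rw [ContinuousLinearMap.nonneg_iff_isPositive, ContinuousLinearMap.isPositive_iff]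
    refine ⟨?_, fun x => ?_⟩
    · rw [← ContinuousLinearMap.star_eq_adjoint]
      exact ((IsSelfAdjoint.one _).sub (IsSelfAdjoint.star_mul_self C)).isSymmetric
    · have h1 : ⟪(1 - C.adjoint * C) x, x⟫_ℂ = ((‖x‖ ^ 2 - ‖C x‖ ^ 2 : ℝ) : ℂ) := by
        simp [ContinuousLinearMap.adjoint_inner_left]
      rw [h1, Complex.zero_le_real]
      have := pow_le_pow_left₀ (norm_nonneg _) (hC x) 2
      linarith
  obtain ⟨D, hD⟩ := CStarAlgebra.nonneg_iff_eq_star_mul_self.mp h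
  refine ⟨D, fun x => ?_⟩
  have h1 : ⟪(1 - C.adjoint * C) x, x⟫_ℂ = ⟪(star D * D) x, x⟫_ℂ := by rw [hD]
  simp only [ContinuousLinearMap.star_eq_adjoint, sub_apply,
    mul_apply_eq_comp, inner_sub_left, ContinuousLinearMap.adjoint_inner_left,
    one_apply_eq_self, inner_self_eq_norm_sq_to_K] at h1
  have h2 : ‖x‖ ^ 2 - ‖C x‖ ^ 2 = ‖D x‖ ^ 2 := by exact_mod_cast h1
  linarith

/-- If `‖F x‖ = ‖G x‖` for all `x`, then `F x ↦ G x` extends to a contraction. -/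
lemma exists_contraction_of_norm_eq [CompleteSpace M] (F G : X →L[ℂ] M)
    (h : ∀ x, ‖F x‖ = ‖G x‖) :
    ∃ A : M →L[ℂ] M, (∀ m, ‖A m‖ ≤ ‖m‖) ∧ ∀ x, A (F x) = G x := by
  let N : Submodule ℂ M := (LinearMap.range (F : X →ₗ[ℂ] M)).topologicalClosure
  have : CompleteSpace N := (Submodule.isClosed_topologicalClosure _).completeSpace_coe
  have hF : ∀ x, (F : X →ₗ[ℂ] M) x ∈ N := fun x =>
    Submodule.le_topologicalClosure _ (LinearMap.mem_range_self _ x)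
  let e : X →ₗ[ℂ] N := (F : X →ₗ[ℂ] M).codRestrict N hF
  have hd : DenseRange e := by
    intro y
    have hy : (y : M) ∈ closure (Set.range F) := by
      simpa [N, Submodule.topologicalClosure] using! y.2
    rw [closure_subtype]
    refine closure_mono ?_ hy
    rintro _ ⟨x, rfl⟩
    exact ⟨e x, ⟨x, rfl⟩, rfl⟩
  have hn : ∀ x, ‖(G : X →ₗ[ℂ] M) x‖ ≤ 1 * ‖e x‖ := fun x => by
    rw [one_mul]
    exact (h x).ge
  -- Extend by continuity to the closure of the range of `F`, and by zero on its orthogonal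
  -- complement.
  refine ⟨(G : X →ₗ[ℂ] M).extendOfNorm e ∘L N.orthogonalProjectionOnto, fun m => ?_, fun x => ?_⟩
  · calc _ ≤ 1 * ‖N.orthogonalProjectionOnto m‖ :=
          LinearMap.norm_extendOfNorm_apply_le hd 1 hn _
      _ ≤ ‖m‖ := by rw [one_mul]; exact N.norm_orthogonalProjectionOnto_apply_le m
  · have h1 : N.orthogonalProjectionOnto (F x) = e x :=
      N.orthogonalProjectionOnto_mem_subspace_eq_self (e x)
    rw [ContinuousLinearMap.comp_apply, h1, LinearMap.extendOfNorm_eq hd ⟨1, hn⟩]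
    rfl

/-- The embedding of `M` as the `n`-th summand of `ℓ²(ℕ, M)`. -/
noncomputable def lpSummand (M : Type*) [NormedAddCommGroup M] [InnerProductSpace ℂ M] (n : ℕ) :
    M →ₗᵢ[ℂ] lp (fun _ : ℕ => M) 2 where
  toLinearMap := lp.lsingle (𝕜 := ℂ) (E := fun _ : ℕ => M) 2 n
  norm_map' := lp.norm_single (E := fun _ : ℕ => M) two_pos n

lemma inner_lpSummand_of_ne {m n : ℕ} (hmn : m ≠ n) (x y : M) :
    ⟪lpSummand M m x, lpSummand M n y⟫_ℂ = 0 := by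
  change ⟪lp.single (E := fun _ : ℕ => M) 2 m x, lp.single (E := fun _ : ℕ => M) 2 n y⟫_ℂ = 0
  rw [lp.inner_single_left, lp.single_apply_ne _ _ _ hmn, inner_zero_right]

/-- The index `n + 1` leaves summand 0 free to receive the defect vector in the dilation. -/
lemma orthogonalFamily_lpSummand_succ (M : Type*) [NormedAddCommGroup M] [InnerProductSpace ℂ M] :
    OrthogonalFamily ℂ (fun _ : ℕ => M) (fun n => lpSummand M (n + 1)) :=
  fun _ _ hmn x y => inner_lpSummand_of_ne (by simpa using hmn) x y

/-- The unilateral shift on `ℓ²(ℕ, M)`. -/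
noncomputable def lpShift (M : Type*) [NormedAddCommGroup M] [InnerProductSpace ℂ M]
    [CompleteSpace M] : lp (fun _ : ℕ => M) 2 →ₗᵢ[ℂ] lp (fun _ : ℕ => M) 2 :=
  (orthogonalFamily_lpSummand_succ M).linearIsometry

lemma inner_lpSummand_zero_lpShift [CompleteSpace M] (x : M) (d : lp (fun _ : ℕ => M) 2) :
    ⟪lpSummand M 0 x, lpShift M d⟫_ℂ = 0 := by
  have h := ((orthogonalFamily_lpSummand_succ M).hasSum_linearIsometry d).mapL
    (innerSL ℂ (lpSummand M 0 x))
  refine h.unique ?_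
  convert hasSum_zero with n
  exact inner_lpSummand_of_ne (Nat.succ_ne_zero n).symm _ _

/-- A contraction on `M` extends to an isometry on `M ⊕ ℓ²(ℕ, M)` that agrees with it on
vectors whose norm it preserves. -/
lemma exists_isometry_dilation [CompleteSpace M] (A : M →L[ℂ] M) (hA : ∀ m, ‖A m‖ ≤ ‖m‖) :
    ∃ W : WithLp 2 (M × lp (fun _ : ℕ => M) 2) →L[ℂ] WithLp 2 (M × lp (fun _ : ℕ => M) 2),
      (∀ k, ‖W k‖ = ‖k‖) ∧
      ∀ m, ‖A m‖ = ‖m‖ → W (WithLp.toLp 2 (m, 0)) = WithLp.toLp 2 (A m, 0) := by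
  obtain ⟨D, hD⟩ := exists_defect_operator A hA
  let E := lp (fun _ : ℕ => M) 2
  let W : WithLp 2 (M × E) →L[ℂ] WithLp 2 (M × E) :=
    ((WithLp.prodContinuousLinearEquiv 2 ℂ M E).symm : (M × E) →L[ℂ] WithLp 2 (M × E)) ∘L
      (A ∘L WithLp.fstL 2 ℂ M E).prod
        ((lpSummand M 0).toContinuousLinearMap ∘L D ∘L WithLp.fstL 2 ℂ M E +
          (lpShift M).toContinuousLinearMap ∘L WithLp.sndL 2 ℂ M E)
  have hW : ∀ k, W k = WithLp.toLp 2 (A k.fst, lpSummand M 0 (D k.fst) + lpShift M k.snd) :=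
    fun _ => rfl
  refine ⟨W, fun k => ?_, fun m hm => ?_⟩
  · rw [← sq_eq_sq₀ (norm_nonneg _) (norm_nonneg _), hW, WithLp.prod_norm_sq_eq_of_L2,
      WithLp.prod_norm_sq_eq_of_L2, ← hD k.fst]
    have h := norm_add_sq_eq_norm_sq_add_norm_sq_of_inner_eq_zero (𝕜 := ℂ) _ _
      (inner_lpSummand_zero_lpShift (D k.fst) k.snd)
    simp only [LinearIsometry.norm_map] at h
    simp only [sq] at h ⊢
    rw [add_assoc, ← h]
    rfl
  · have h0 : D m = 0 := by
      have := hD m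
      rw [hm] at this
      simpa using this
    rw [hW]
    simp [h0]

end Dilation

section UpperBlock

variable {H₀ H₁ : Type*} [NormedAddCommGroup H₀] [InnerProductSpace ℂ H₀]
  [NormedAddCommGroup H₁] [InnerProductSpace ℂ H₁]

lemma upperBlock_apply (A : H₀ →L[ℂ] H₀) (C : H₁ →L[ℂ] H₀) (B : H₁ →L[ℂ] H₁)
    (z : WithLp 2 (H₀ × H₁)) :
    upperBlock A C B z = WithLp.toLp 2 (A z.fst + C z.snd, B z.snd) := rfl

/-- On a complex space an operator is determined by its quadratic form. -/
lemma isMIsometry_iff_sum_norm_sq [CompleteSpace H₀] (m : ℕ) (S : H₀ →L[ℂ] H₀) :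
    IsMIsometry m S ↔
      ∀ x, ∑ j ∈ Finset.range (m + 1), (-1 : ℝ) ^ j * m.choose j * ‖(S ^ j) x‖ ^ 2 = 0 := by
  have key : ∀ x, ⟪(∑ j ∈ Finset.range (m + 1),
      ((-1 : ℂ) ^ j * (m.choose j : ℂ)) • (S.adjoint ^ j * S ^ j)) x, x⟫_ℂ =
      ((∑ j ∈ Finset.range (m + 1), (-1 : ℝ) ^ j * m.choose j * ‖(S ^ j) x‖ ^ 2 : ℝ) : ℂ) := by
    intro x
    rw [sum_apply, sum_inner, Complex.ofReal_sum]
    refine Finset.sum_congr rfl fun j _ => ?_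
    rw [← ContinuousLinearMap.star_eq_adjoint, ← star_pow, ContinuousLinearMap.star_eq_adjoint,
      smul_apply, inner_smul_left, mul_apply_eq_comp,
      ContinuousLinearMap.adjoint_inner_left, inner_self_eq_norm_sq_to_K]
    simp
  unfold IsMIsometry
  constructor
  · intro h x
    have := key x
    rw [h] at this
    exact_mod_cast (inner_zero_left (𝕜 := ℂ) x ▸ this).symm
  · intro h
    have : ∀ T : H₀ →L[ℂ] H₀, (∀ x, ⟪T x, x⟫_ℂ = 0) → T = 0 := fun T hT =>
      ContinuousLinearMap.coe_injective ((inner_map_self_eq_zero (T : H₀ →ₗ[ℂ] H₀)).mp hT)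
    refine this _ fun x => ?_
    rw [key, h, Complex.ofReal_zero]

/-- If `A` and `B` are isometries and `A C = C B`, then `(A, C; 0, B)` is a 3-isometry. -/
lemma isMIsometry_three_upperBlock [CompleteSpace H₀] [CompleteSpace H₁]
    {A : H₀ →L[ℂ] H₀} {C : H₁ →L[ℂ] H₀} {B : H₁ →L[ℂ] H₁}
    (hA : ∀ x, ‖A x‖ = ‖x‖) (hB : ∀ y, ‖B y‖ = ‖y‖) (hC : ∀ y, A (C y) = C (B y)) :
    IsMIsometry 3 (upperBlock A C B) := by
  rw [isMIsometry_iff_sum_norm_sq]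
  intro z
  obtain ⟨x, y⟩ := z
  -- Since A C = C B, the off-diagonal terms of the n-th power collect into n copies of C y.
  have e2 : A (A x + C y) + C (B y) = A (A x + (2 : ℂ) • C y) := by
    rw [two_smul]
    simp only [map_add, hC]
    abel
  have e3 : A (A (A x + C y) + C (B y)) + C (B (B y)) = A (A (A x + (3 : ℂ) • C y)) := by
    rw [show (3 : ℂ) = 2 + 1 by norm_num, add_smul, two_smul, one_smul]
    simp only [map_add, hC]
    abel
  have n1 := norm_add_sq (𝕜 := ℂ) (A x) (C y)
  have n2 := norm_add_sq (𝕜 := ℂ) (A x) ((2 : ℂ) • C y)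
  have n3 := norm_add_sq (𝕜 := ℂ) (A x) ((3 : ℂ) • C y)
  have r2 : RCLike.re ⟪A x, (2 : ℂ) • C y⟫_ℂ = 2 * RCLike.re ⟪A x, C y⟫_ℂ := by
    simp
  have r3 : RCLike.re ⟪A x, (3 : ℂ) • C y⟫_ℂ = 3 * RCLike.re ⟪A x, C y⟫_ℂ := by
    simp
  rw [r2, norm_smul, hA, Complex.norm_ofNat] at n2
  rw [r3, norm_smul, hA, Complex.norm_ofNat] at n3
  rw [hA] at n1
  have p1 : ‖(upperBlock A C B ^ 1) (WithLp.toLp 2 (x, y))‖ ^ 2 = ‖A x + C y‖ ^ 2 + ‖y‖ ^ 2 := by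
    rw [pow_one, upperBlock_apply, WithLp.prod_norm_sq_eq_of_L2]
    simp only [WithLp.toLp_fst, WithLp.toLp_snd, hB]
  have p2 : ‖(upperBlock A C B ^ 2) (WithLp.toLp 2 (x, y))‖ ^ 2 =
      ‖A x + (2 : ℂ) • C y‖ ^ 2 + ‖y‖ ^ 2 := by
    rw [pow_two (upperBlock A C B), mul_apply_eq_comp, upperBlock_apply, upperBlock_apply,
      WithLp.prod_norm_sq_eq_of_L2]
    simp only [WithLp.toLp_fst, WithLp.toLp_snd, hB]
    rw [e2, hA]
  have p3 : ‖(upperBlock A C B ^ 3) (WithLp.toLp 2 (x, y))‖ ^ 2 =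
      ‖A x + (3 : ℂ) • C y‖ ^ 2 + ‖y‖ ^ 2 := by
    rw [pow_succ (upperBlock A C B), pow_two (upperBlock A C B), mul_apply_eq_comp, mul_apply_eq_comp, upperBlock_apply,
      upperBlock_apply, upperBlock_apply, WithLp.prod_norm_sq_eq_of_L2]
    simp only [WithLp.toLp_fst, WithLp.toLp_snd, hB]
    rw [e3, hA, hA]
  have p0 : ‖WithLp.toLp 2 (x, y)‖ ^ 2 = ‖x‖ ^ 2 + ‖y‖ ^ 2 := WithLp.prod_norm_sq_eq_of_L2 _
  simp only [Finset.sum_range_succ, Finset.sum_range_zero, p1, p2, p3, n1, n2, n3, pow_zero,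
    one_apply_eq_self, p0]
  -- The weights 1, -3, 3, -1 annihilate quadratic polynomials in the exponent.
  norm_num [Nat.choose]
  ring

end UpperBlock

/-- An intertwining lift of a Hankel operator: there are a Hilbert space
`K ⊇ H`, an isometry `W` on `K` whose adjoint extends `V`, and an operator `B : H → K` that lifts
`C` and satisfies `W B = B V`. -/
lemma exists_isometric_lifting_of_hankel.{u} {H : Type u} [NormedAddCommGroup H]
    [InnerProductSpace ℂ H] [CompleteSpace H] {V C : H →L[ℂ] H} (hV : ∀ x, ‖V x‖ = ‖x‖)
    (hC : IsHankelOperator V C) :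
    ∃ (K : Type u) (_ : NormedAddCommGroup K) (_ : InnerProductSpace ℂ K) (_ : CompleteSpace K)
      (a : H →ₗᵢ[ℂ] K) (W : K →L[ℂ] K) (B : H →L[ℂ] K), (∀ k, ‖W k‖ = ‖k‖) ∧
      (∀ x, W (a (V x)) = a x) ∧ (∀ y, W (B y) = B (V y)) ∧
      ∀ y x, ⟪B y, a x⟫_ℂ = ⟪C y, x⟫_ℂ := by
  replace hC : ∀ x, C (V x) = V.adjoint (C x) := fun x => DFunLike.congr_fun hC x
  -- Adding 1 keeps the scale invertible when C = 0.
  have hγ : 0 < ‖C‖ + 1 := by positivity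
  let γ : ℂ := ((‖C‖ + 1 : ℝ) : ℂ)
  have hγ0 : γ ≠ 0 := Complex.ofReal_ne_zero.mpr hγ.ne'
  let C₀ : H →L[ℂ] H := γ⁻¹ • C
  have hC₀ : ∀ x, ‖C₀ x‖ ≤ ‖x‖ := fun x => by
    have h1 : ‖C₀ x‖ = (‖C‖ + 1)⁻¹ * ‖C x‖ := by
      change ‖γ⁻¹ • C x‖ = _
      rw [norm_smul, norm_inv, Complex.norm_of_nonneg hγ.le]
    rw [h1, inv_mul_le_iff₀ hγ]
    refine (C.le_opNorm x).trans ?_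
    gcongr
    linarith
  -- The Hankel relation, as the equality of the cross terms in ‖F z‖² and ‖G z‖².
  have hCV : ∀ x y, ⟪V x, C₀ y⟫_ℂ = ⟪x, C₀ (V y)⟫_ℂ := fun x y => by
    change ⟪V x, γ⁻¹ • C y⟫_ℂ = ⟪x, γ⁻¹ • C (V y)⟫_ℂ
    rw [inner_smul_right, inner_smul_right, hC, ContinuousLinearMap.adjoint_inner_right]
  obtain ⟨D, hD⟩ := exists_defect_operator C₀ hC₀
  -- `F` runs over the vectors on which W is prescribed, `G` over their required images.
  let F := upperBlock V C₀ D
  let G := upperBlock 1 (C₀ ∘L V) (D ∘L V)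
  have hFG : ∀ z, ‖F z‖ = ‖G z‖ := by
    rintro ⟨x, y⟩
    have hF : ‖F (WithLp.toLp 2 (x, y))‖ ^ 2 = ‖V x + C₀ y‖ ^ 2 + ‖D y‖ ^ 2 :=
      WithLp.prod_norm_sq_eq_of_L2 _
    have hG : ‖G (WithLp.toLp 2 (x, y))‖ ^ 2 = ‖x + C₀ (V y)‖ ^ 2 + ‖D (V y)‖ ^ 2 :=
      WithLp.prod_norm_sq_eq_of_L2 _
    have h1 := hD y
    have h2 := hD (V y)
    rw [hV] at h2
    rw [norm_add_sq (𝕜 := ℂ), hV, hCV] at hF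
    rw [norm_add_sq (𝕜 := ℂ)] at hG
    rw [← sq_eq_sq₀ (norm_nonneg _) (norm_nonneg _), hF, hG]
    linarith
  obtain ⟨A, hA, hAF⟩ := exists_contraction_of_norm_eq F G hFG
  obtain ⟨W, hW, hWA⟩ := exists_isometry_dilation A hA
  let M := WithLp 2 (H × H)
  let E := lp (fun _ : ℕ => M) 2
  have hWF : ∀ z, W (WithLp.toLp 2 (F z, 0)) = WithLp.toLp 2 (G z, 0) := fun z => by
    rw [hWA _ (by rw [hAF, hFG]), hAF]
  let j : M →L[ℂ] WithLp 2 (M × E) :=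
    ((WithLp.prodContinuousLinearEquiv 2 ℂ M E).symm : (M × E) →L[ℂ] WithLp 2 (M × E)) ∘L
      ContinuousLinearMap.inl ℂ M E
  let i : H →L[ℂ] M :=
    ((WithLp.prodContinuousLinearEquiv 2 ℂ H H).symm : (H × H) →L[ℂ] M) ∘L
      ContinuousLinearMap.inl ℂ H H
  let b : H →L[ℂ] M :=
    ((WithLp.prodContinuousLinearEquiv 2 ℂ H H).symm : (H × H) →L[ℂ] M) ∘L C₀.prod D
  have hj : ∀ m m', ⟪j m, j m'⟫_ℂ = ⟪m, m'⟫_ℂ := fun m m' => by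
    change ⟪(WithLp.toLp 2 (m, 0) : WithLp 2 (M × E)), WithLp.toLp 2 (m', 0)⟫_ℂ = _
    simp [WithLp.prod_inner_apply]
  have hi : ∀ m x, ⟪m, i x⟫_ℂ = ⟪m.fst, x⟫_ℂ := fun m x => by
    refine (WithLp.prod_inner_apply m (i x)).trans ?_
    change ⟪m.fst, x⟫_ℂ + ⟪m.snd, 0⟫_ℂ = _
    rw [inner_zero_right, add_zero]
  refine ⟨WithLp 2 (M × E), inferInstance, inferInstance, inferInstance,
    LinearMap.isometryOfInner ((j ∘L i : H →L[ℂ] _) : H →ₗ[ℂ] _) fun x y => ?_,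
    W, γ • (j ∘L b), hW, fun x => ?_, fun y => ?_, fun y x => ?_⟩
  · exact (hj _ _).trans (hi _ _)
  · have h1 : F (WithLp.toLp 2 (x, 0)) = i (V x) := by
      change WithLp.toLp 2 (V x + C₀ 0, D 0) = WithLp.toLp 2 (V x, 0)
      simp
    have h2 : G (WithLp.toLp 2 (x, 0)) = i x := by
      change WithLp.toLp 2 (x + C₀ (V 0), D (V 0)) = WithLp.toLp 2 (x, 0)
      simp
    have h3 := hWF (WithLp.toLp 2 (x, 0))
    rw [h1, h2] at h3
    exact h3
  · have h1 : F (WithLp.toLp 2 (0, y)) = b y := by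
      change WithLp.toLp 2 (V 0 + C₀ y, D y) = WithLp.toLp 2 (C₀ y, D y)
      simp
    have h2 : G (WithLp.toLp 2 (0, y)) = b (V y) := by
      change WithLp.toLp 2 (0 + C₀ (V y), D (V y)) = WithLp.toLp 2 (C₀ (V y), D (V y))
      simp
    have h3 := hWF (WithLp.toLp 2 (0, y))
    rw [h1, h2] at h3
    change W (γ • j (b y)) = γ • j (b (V y))
    rw [map_smul]
    exact congrArg (γ • ·) h3
  · change ⟪γ • j (b y), j (i x)⟫_ℂ = _
    rw [inner_smul_left, hj, hi]
    change _ * ⟪γ⁻¹ • C y, x⟫_ℂ = _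
    rw [inner_smul_left, ← mul_assoc, ← map_mul, mul_inv_cancel₀ hγ0, map_one, one_mul]

theorem corollary4p2 {H : Type*} [NormedAddCommGroup H] [InnerProductSpace ℂ H] [CompleteSpace H]
    (T : WithLp 2 (H × H) →L[ℂ] WithLp 2 (H × H)) (hT : IsFoguelHankel T) :
    HasMIsometricLifting 3 T := by
  obtain ⟨V, C, hV, hC, rfl⟩ := hT
  obtain ⟨K, _, _, _, a, W, B, hW, hWa, hWB, hB⟩ :=
    exists_isometric_lifting_of_hankel hV.isometry hC
  have hWW : ∀ k k', ⟪W k, W k'⟫_ℂ = ⟪k, k'⟫_ℂ :=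
    (LinearIsometry.mk (W : K →ₗ[ℂ] K) hW).inner_map_map
  -- W* extends V: apply W* to W a V = a and use W* W = 1.
  have hWa' : ∀ k x, ⟪W k, a x⟫_ℂ = ⟪k, a (V x)⟫_ℂ := fun k x => by rw [← hWa, hWW]
  let ι : WithLp 2 (H × H) →ₗ[ℂ] WithLp 2 (K × H) :=
    ((WithLp.linearEquiv 2 ℂ (K × H)).symm : (K × H) →ₗ[ℂ] WithLp 2 (K × H)) ∘ₗ
      (a.toLinearMap.prodMap LinearMap.id) ∘ₗ
        (WithLp.linearEquiv 2 ℂ (H × H) : WithLp 2 (H × H) →ₗ[ℂ] (H × H))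
  have hι : ∀ k z, ⟪k, ι z⟫_ℂ = ⟪k.fst, a z.fst⟫_ℂ + ⟪k.snd, z.snd⟫_ℂ := fun _ _ =>
    WithLp.prod_inner_apply _ _
  let ι' : WithLp 2 (H × H) →ₗᵢ[ℂ] WithLp 2 (K × H) := ι.isometryOfInner fun x y => by
    rw [hι, WithLp.prod_inner_apply]
    exact congrArg₂ _ (a.inner_map_map _ _) rfl
  refine ⟨WithLp 2 (K × H), inferInstance, inferInstance, inferInstance, ι',
    upperBlock W B V, isMIsometry_three_upperBlock hW hV.isometry hWB, ?_⟩
  have hadj : ∀ k, ι'.toContinuousLinearMap.adjoint k =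
      WithLp.toLp 2 (a.toContinuousLinearMap.adjoint k.fst, k.snd) := fun k => by
    refine ext_inner_right ℂ fun z => ?_
    rw [ContinuousLinearMap.adjoint_inner_left, WithLp.prod_inner_apply]
    refine (hι k z).trans (congrArg₂ _ ?_ rfl)
    exact (ContinuousLinearMap.adjoint_inner_left a.toContinuousLinearMap _ _).symm
  ext k : 1
  rw [ContinuousLinearMap.comp_apply, ContinuousLinearMap.comp_apply, hadj, hadj,
    upperBlock_apply, upperBlock_apply]
  congr 2
  refine ext_inner_right ℂ fun x => ?_
  simp only [WithLp.toLp_fst, WithLp.toLp_snd, inner_add_left,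
    ContinuousLinearMap.adjoint_inner_left, LinearIsometry.coe_toContinuousLinearMap, map_add,
    hWa', hB]
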